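/- Let $d\in\mathbb{N}$. Call a polynomial $p\in\mathbb{R}[z]$ hyperbolic if all its complex roots are real. Let $$\mathcal H_1^d=\Big\{b=(b_1,\dots,b_d)\in\mathbb{R}^d:\ z^d+\sum_{k=1}^d b_kz^{d-k}\ \text{is hyperbolic}\Big\}$$ be the set of coefficient vectors of monic hyperbolic polynomials of degree $d$. Let $\mathcal N_d$ be the set of Nuij sequences in $\mathbb{R}^d$, that is, of all $a=(a_1,\dots,a_d)\in\mathbb{R}^d$ such that for every hyperbolic polynomial $p\in\mathbb{R}[z]$ of degree $d$ and every $s\in\mathbb{R}$ the polynomial $$p_a(z,s)=p(z)+\sum_{k=1}^d a_k s^k p^{(k)}(z)$$ in $z$ is hyperbolic. Let $b_d:\mathbb{R}^d\to\mathbb{R}^d$ be the linear map $$b_d(a_1,\dots,a_k,\dots,a_d)=\Big(d\,a_1,\dots,\tfrac{d!}{(d-k)!}\,a_k,\dots,d!\,a_d\Big).$$ Then $$\mathcal H_1^d\subseteq\mathcal N_d=b_d^{-1}(\mathcal H_1^d).$$ -/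

import Mathlib

open Polynomial

namespace Nuij

/-- A real polynomial is hyperbolic if all its (complex) roots are real.
The zero polynomial is not hyperbolic, nonzero constants are. -/
def Hyperbolic (p : ℝ[X]) : Prop :=
  ∀ z : ℂ, aeval z p = 0 → z.im = 0

/-- The monic polynomial `h_b = z ^ d + ∑_{k=1}^d b_k z ^ (d - k)` with coefficient vector
`b = (b_1, …, b_d)`; the entry `b_k` is `b i` with `k = i + 1`. -/
noncomputable def monicPoly (d : ℕ) (b : Fin d → ℝ) : ℝ[X] :=
  X ^ d + ∑ i : Fin d, C (b i) * X ^ (d - ((i : ℕ) + 1))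

/-- The set `𝓗_1^d` of coefficient vectors of monic hyperbolic polynomials of degree `d`. -/
def hyperbolicSet (d : ℕ) : Set (Fin d → ℝ) :=
  {b | Hyperbolic (monicPoly d b)}

/-- The polynomial `p_a(z, s) = p(z) + ∑_{k=1}^d a_k s ^ k p^{(k)}(z)` in `z`; the entry `a_k` is
`a i` with `k = i + 1`. -/
noncomputable def nuijPoly (d : ℕ) (a : Fin d → ℝ) (p : ℝ[X]) (s : ℝ) : ℝ[X] :=
  p + ∑ i : Fin d, C (a i * s ^ ((i : ℕ) + 1)) * derivative^[(i : ℕ) + 1] p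

/-- `a ∈ ℝ^d` is a Nuij sequence if `p_a(·, s)` is hyperbolic for every hyperbolic `p` of
degree `d` and every real `s`. -/
def IsNuijSequence (d : ℕ) (a : Fin d → ℝ) : Prop :=
  ∀ p : ℝ[X], p.degree = d → Hyperbolic p → ∀ s : ℝ, Hyperbolic (nuijPoly d a p s)

/-- The set `𝒩_d` of all Nuij sequences in `ℝ^d`. -/
def nuijSet (d : ℕ) : Set (Fin d → ℝ) :=
  {a | IsNuijSequence d a}

/-- The linear map `b_d : ℝ^d → ℝ^d`, `(b_d a)_k = (d! / (d - k)!) a_k`; here `k = i + 1`. -/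
noncomputable def scaleMap (d : ℕ) : (Fin d → ℝ) →ₗ[ℝ] (Fin d → ℝ) where
  toFun a := fun i => ((d.factorial : ℝ) / ((d - ((i : ℕ) + 1)).factorial : ℝ)) * a i
  map_add' a b := by
    funext i
    simp only [Pi.add_apply, mul_add]
  map_smul' c a := by
    funext i
    simp only [Pi.smul_apply, smul_eq_mul, RingHom.id_apply]
    ring

end Nuij

/-!
Everything rests on one estimate going back to Laguerre. If a complex polynomial `q` of degree at
most `n` has no root in the open upper half plane, then at a point `z` of that half plane the
logarithmic derivative `q' / q` is a sum of numbers `1 / (z - α)` with `Im α ≤ 0`. Each of these,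
as well as `0`, lies in the closed disk with centre `-i / (2 Im z)` and radius `1 / (2 Im z)`, so
`q'(z) / q(z)` lies in the same disk blown up by the factor `n`
(`norm_derivative_div_eval_add_le`). This has two consequences.

* The origin is the only real number in that disk, so `p - t p'` is hyperbolic whenever `p` is
  (`Hyperbolic.sub_C_mul_derivative`). If `z ^ d + ∑ a_k z ^ (d - k) = ∏ (z - r_i)` with real `r_i`,
  then `1 + ∑ a_k s ^ k D ^ k = ∏ (1 - r_i s D)`, where `D` is differentiation, so `a` is a Nuij
  sequence.
* For `β` in the open upper half plane the polar derivative `n q + (β - z) q'` has no root there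
  either (`eval_polarDerivative_ne_zero`). Splitting off the roots of `f` one at a time turns this
  into Grace's apolarity theorem: if all `n` roots of `f` lie in the open upper half plane and `q`
  has no root there, then `∑ (-1) ^ k f^{(k)} q^{(n - k)}` does not vanish
  (`eval_apolarForm_ne_zero`). For `f(z) = p(w - z)` and `q` the monic polynomial with coefficient
  vector `b_d a`, the value of this sum at `0` is `d!` times `p_a(w, 1)`. Hence `b_d a ∈ 𝓗_1^d`
  implies that `a` is a Nuij sequence.

Conversely, `p(z) = z ^ d` and `s = 1` give for `p_a` exactly the monic polynomial with coefficient
vector `b_d a`.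
-/

open Polynomial

namespace Nuij

/-! ### Laguerre's estimate for the logarithmic derivative -/

/-- The closed disk with diameter from `0` to `-I / y`, where `y = Im z`, is the image of the closed
lower half plane under `α ↦ 1 / (z - α)`, together with `0`. -/
lemma norm_inv_sub_add_le_iff {z α : ℂ} (hz : 0 < z.im) (h : z ≠ α) :
    ‖1 / (z - α) + Complex.I / (2 * z.im)‖ ≤ ‖Complex.I / (2 * z.im : ℂ)‖ ↔ α.im ≤ 0 := by
  have hsub : z - α ≠ 0 := sub_ne_zero.2 h
  have hy : (z.im : ℂ) ≠ 0 := by exact_mod_cast hz.ne'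
  have key : 1 / (z - α) + Complex.I / (2 * z.im) =
      (2 * z.im + Complex.I * (z - α)) * ((z - α)⁻¹ * (2 * z.im : ℂ)⁻¹) := by
    field_simp
  have key2 : Complex.I / (2 * z.im : ℂ) =
      (z - α) * ((z - α)⁻¹ * (2 * z.im : ℂ)⁻¹) * Complex.I := by
    field_simp
  have hpos : 0 < ‖(z - α)⁻¹ * (2 * z.im : ℂ)⁻¹‖ :=
    norm_pos_iff.2 (mul_ne_zero (inv_ne_zero hsub) (inv_ne_zero (mul_ne_zero two_ne_zero hy)))
  rw [key, key2, norm_mul, norm_mul _ Complex.I, norm_mul (z - α), Complex.norm_I, mul_one,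
    mul_le_mul_iff_left₀ hpos, ← sq_le_sq₀ (norm_nonneg _) (norm_nonneg _),
    Complex.sq_norm, Complex.sq_norm, Complex.normSq_apply, Complex.normSq_apply]
  simp only [Complex.add_re, Complex.mul_re, Complex.re_ofNat, Complex.ofReal_re, Complex.im_ofNat,
    Complex.ofReal_im, Complex.I_re, Complex.I_im, Complex.sub_re, Complex.sub_im, Complex.add_im,
    Complex.mul_im]
  constructor
  · intro h'
    by_contra! hα
    nlinarith [mul_pos hz hα]
  · intro hα
    nlinarith [mul_nonneg hz.le (neg_nonneg.2 hα)]

/-- Every root `α` contributes `1 / (z - α)`, and each of the `n - deg q` missing roots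
contributes `0`; all of these lie in one disk through `0`. -/
lemma norm_derivative_div_eval_add_le {q : ℂ[X]} {n : ℕ} (hn : q.natDegree ≤ n)
    (hq : ∀ z : ℂ, 0 < z.im → q.eval z ≠ 0) {z : ℂ} (hz : 0 < z.im) :
    ‖q.derivative.eval z / q.eval z + n * (Complex.I / (2 * z.im))‖ ≤
      n * ‖Complex.I / (2 * z.im : ℂ)‖ := by
  have hsplit := IsAlgClosed.splits q
  have hsum : ∀ s : Multiset ℂ, (∀ α ∈ s, α.im ≤ 0) →
      ‖(s.map fun α => 1 / (z - α)).sum + s.card * (Complex.I / (2 * z.im))‖ ≤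
        s.card * ‖Complex.I / (2 * z.im : ℂ)‖ := by
    intro s
    induction s using Multiset.induction_on with
    | empty => simp
    | cons α s ih =>
      intro hs
      have hα : α.im ≤ 0 := hs α (Multiset.mem_cons_self _ _)
      have hne : z ≠ α := by
        rintro rfl
        exact absurd hz (not_lt.2 hα)
      have h1 := (norm_inv_sub_add_le_iff hz hne).2 hα
      have h2 := ih fun β hβ => hs β (Multiset.mem_cons_of_mem hβ)
      rw [Multiset.map_cons, Multiset.sum_cons, Multiset.card_cons]
      push_cast
      calc _ = ‖(1 / (z - α) + Complex.I / (2 * z.im)) +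
            ((s.map fun α => 1 / (z - α)).sum + s.card * (Complex.I / (2 * z.im)))‖ := by
              congr 1; ring
        _ ≤ _ := norm_add_le _ _
        _ ≤ _ := by linarith
  have hroots := hsum q.roots fun α hα => by
    by_contra! h
    exact hq α h (isRoot_of_mem_roots hα)
  rw [hsplit.eval_derivative_div_eval_of_ne_zero (hq z hz)]
  obtain ⟨m, rfl⟩ := Nat.exists_eq_add_of_le (hsplit.natDegree_eq_card_roots ▸ hn)
  have hm : ‖(m : ℂ) * (Complex.I / (2 * z.im))‖ = m * ‖Complex.I / (2 * z.im : ℂ)‖ := by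
    rw [norm_mul, Complex.norm_natCast]
  push_cast
  calc _ = ‖((q.roots.map fun α => 1 / (z - α)).sum + q.roots.card * (Complex.I / (2 * z.im))) +
        m * (Complex.I / (2 * z.im))‖ := by congr 1; ring
    _ ≤ _ := norm_add_le _ _
    _ ≤ _ := by linarith

/-! ### Polar derivatives and Grace's apolarity theorem -/

/-- The polar derivative `n q + (β - X) q'` of `q`, regarded as a polynomial of degree `n`, with
respect to the pole `β`. -/
noncomputable def polarDerivative (n : ℕ) (β : ℂ) (q : ℂ[X]) : ℂ[X] :=
  C (n : ℂ) * q + (C β - X) * derivative q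

lemma eval_polarDerivative_ne_zero {q : ℂ[X]} {n : ℕ} (hn : q.natDegree ≤ n) (hn0 : n ≠ 0)
    (hq : ∀ z : ℂ, 0 < z.im → q.eval z ≠ 0) {β z : ℂ} (hβ : 0 < β.im) (hz : 0 < z.im) :
    (polarDerivative n β q).eval z ≠ 0 := by
  intro h
  simp only [polarDerivative, eval_add, eval_mul, eval_C, eval_sub, eval_X] at h
  have hqz := hq z hz
  have hn' : (n : ℂ) ≠ 0 := Nat.cast_ne_zero.2 hn0
  have hne : z ≠ β := by
    rintro rfl
    simp_all
  have hsub : z - β ≠ 0 := sub_ne_zero.2 hne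
  -- A zero of the polar derivative would make `1 / (z - β)` the mean of the `1 / (z - α)`.
  have hW : q.derivative.eval z / q.eval z = n * (1 / (z - β)) := by
    field_simp
    linear_combination -h
  have hle := norm_derivative_div_eval_add_le hn hq hz
  rw [hW, ← mul_add, norm_mul, Complex.norm_natCast,
    mul_le_mul_iff_right₀ (by positivity), norm_inv_sub_add_le_iff hz hne] at hle
  exact absurd hβ (not_lt.2 hle)

lemma natDegree_polarDerivative_le {q : ℂ[X]} {n : ℕ} (hn : q.natDegree ≤ n + 1) (β : ℂ) :
    (polarDerivative (n + 1) β q).natDegree ≤ n := by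
  rw [natDegree_le_iff_coeff_eq_zero]
  intro m hm
  obtain ⟨m, rfl⟩ : ∃ k, m = k + 1 := ⟨m - 1, by omega⟩
  have h2 : q.coeff (m + 2) = 0 := coeff_eq_zero_of_natDegree_lt (by omega)
  have : ((n : ℂ) - m) * q.coeff (m + 1) = 0 := by
    rcases eq_or_ne n m with rfl | h
    · simp
    · rw [coeff_eq_zero_of_natDegree_lt (by omega), mul_zero]
  simp only [polarDerivative, sub_mul, coeff_add, coeff_sub, coeff_C_mul, coeff_X_mul,
    coeff_derivative, add_assoc]
  norm_num [h2]
  linear_combination this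

/-- The apolarity pairing `∑ (-1) ^ k f^{(k)} q^{(n - k)}`. For `f` and `q` of degree at most `n`
it is a constant polynomial, but its constancy plays no role below. -/
noncomputable def apolarForm (n : ℕ) (f q : ℂ[X]) : ℂ[X] :=
  ∑ k ∈ Finset.range (n + 1), (-1) ^ k * derivative^[k] f * derivative^[n - k] q

lemma iterate_derivative_X_sub_C_mul_succ (β : ℂ) (g : ℂ[X]) (k : ℕ) :
    derivative^[k + 1] ((X - C β) * g) =
      (X - C β) * derivative^[k + 1] g + C ((k : ℂ) + 1) * derivative^[k] g := by
  induction k with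
  | zero => simp [derivative_mul]; ring
  | succ k ih =>
    rw [Function.iterate_succ_apply', ih]
    simp only [derivative_add, derivative_mul, derivative_C, derivative_sub, derivative_X,
      Function.iterate_succ_apply', C_add, C_1, derivative_one, Nat.cast_succ]
    ring

lemma iterate_derivative_polarDerivative (n k : ℕ) (β : ℂ) (q : ℂ[X]) :
    derivative^[k] (polarDerivative n β q) =
      C ((n : ℂ) - k) * derivative^[k] q + (C β - X) * derivative^[k + 1] q := by
  induction k with
  | zero => simp [polarDerivative]
  | succ k ih =>
    rw [Function.iterate_succ_apply', ih]
    simp only [derivative_add, derivative_mul, derivative_C, derivative_sub, derivative_X,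
      Function.iterate_succ_apply', C_sub, C_add, C_1, Nat.cast_succ]
    ring

/-- Splitting off the root `β` of one argument of the apolarity pairing replaces the other
argument by its polar derivative with pole `β`. -/
lemma apolarForm_X_sub_C_mul {n : ℕ} {g : ℂ[X]} (hg : g.natDegree ≤ n) (β : ℂ) (q : ℂ[X]) :
    apolarForm (n + 1) ((X - C β) * g) q = -apolarForm n g (polarDerivative (n + 1) β q) := by
  have hg0 : derivative^[n + 1] g = 0 := iterate_derivative_eq_zero (by omega)
  have h1 : apolarForm (n + 1) ((X - C β) * g) q =
      ∑ k ∈ Finset.range (n + 2),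
        (-1) ^ k * ((X - C β) * derivative^[k] g) * derivative^[n + 1 - k] q +
      ∑ k ∈ Finset.range (n + 1),
        (-1) ^ (k + 1) * (C ((k : ℂ) + 1) * derivative^[k] g) * derivative^[n - k] q := by
    rw [apolarForm, Finset.sum_range_succ', Finset.sum_range_succ' _ (n + 1), add_right_comm,
      ← Finset.sum_add_distrib]
    congr 1
    refine Finset.sum_congr rfl fun k _ => ?_
    rw [iterate_derivative_X_sub_C_mul_succ, Nat.add_sub_add_right]
    ring
  rw [h1, Finset.sum_range_succ, hg0, mul_zero, mul_zero, zero_mul, add_zero,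
    ← Finset.sum_add_distrib, apolarForm, ← Finset.sum_neg_distrib]
  refine Finset.sum_congr rfl fun k hk => ?_
  have hk' : k ≤ n := Nat.lt_succ_iff.1 (Finset.mem_range.1 hk)
  have hcast : ((n + 1 : ℕ) : ℂ) - ((n - k : ℕ) : ℂ) = k + 1 := by
    push_cast [Nat.cast_sub hk']
    ring
  rw [iterate_derivative_polarDerivative, hcast, Nat.sub_add_comm hk']
  ring

/-- Grace's apolarity theorem for the upper half plane. -/
lemma eval_apolarForm_ne_zero (s : Multiset ℂ) (hs : ∀ β ∈ s, 0 < β.im) {c : ℂ} (hc : c ≠ 0)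
    {q : ℂ[X]} (hdeg : q.natDegree ≤ s.card) (hq : ∀ z : ℂ, 0 < z.im → q.eval z ≠ 0) (x : ℂ) :
    (apolarForm s.card (C c * (s.map fun β => X - C β).prod) q).eval x ≠ 0 := by
  induction s using Multiset.induction_on generalizing q with
  | empty =>
    obtain ⟨e, rfl⟩ := natDegree_eq_zero.1 (Nat.le_zero.1 hdeg)
    have he : e ≠ 0 := by simpa using hq Complex.I (by simp)
    simp [apolarForm, hc, he]
  | cons β s ih =>
    rw [Multiset.card_cons] at hdeg ⊢
    have hβ : 0 < β.im := hs β (Multiset.mem_cons_self _ _)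
    have hg : (C c * (s.map fun β => X - C β).prod).natDegree ≤ s.card := by
      rw [natDegree_C_mul hc, natDegree_multiset_prod_X_sub_C_eq_card]
    rw [Multiset.map_cons, Multiset.prod_cons, mul_left_comm, apolarForm_X_sub_C_mul hg, eval_neg,
      neg_ne_zero]
    exact ih (fun γ hγ => hs γ (Multiset.mem_cons_of_mem hγ))
      (natDegree_polarDerivative_le hdeg β)
      fun z hz => eval_polarDerivative_ne_zero hdeg (Nat.succ_ne_zero _) hq hβ hz

/-! ### Hyperbolic polynomials -/

/-- The roots of a real polynomial are symmetric about the real axis, so only one half plane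
matters. -/
lemma hyperbolic_iff {p : ℝ[X]} : Hyperbolic p ↔ ∀ z : ℂ, 0 < z.im → aeval z p ≠ 0 := by
  refine ⟨fun h z hz h0 => hz.ne' (h z h0), fun h z h0 => ?_⟩
  rcases lt_trichotomy z.im 0 with hz | hz | hz
  · refine absurd ?_ (h (starRingEnd ℂ z) (by simpa using hz))
    rw [aeval_conj, h0, map_zero]
  · exact hz
  · exact absurd h0 (h z hz)

lemma Hyperbolic.eval_map_ne_zero {p : ℝ[X]} (hp : Hyperbolic p) {z : ℂ} (hz : 0 < z.im) :
    (p.map (algebraMap ℝ ℂ)).eval z ≠ 0 := by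
  rw [eval_map_algebraMap]
  exact hyperbolic_iff.1 hp z hz

lemma Hyperbolic.splits {p : ℝ[X]} (hp : Hyperbolic p) : p.Splits := by
  refine Splits.of_splits_map (algebraMap ℝ ℂ) (IsAlgClosed.splits _) fun z hz => ?_
  have h0 := isRoot_of_mem_roots hz
  rw [IsRoot.def, eval_map_algebraMap] at h0
  exact ⟨z.re, Complex.ext (by simp) (by simp [hp z h0])⟩

lemma Hyperbolic.sub_C_mul_derivative {p : ℝ[X]} (hp : Hyperbolic p) (t : ℝ) :
    Hyperbolic (p - C t * derivative p) := by
  refine hyperbolic_iff.2 fun z hz h0 => ?_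
  set q := p.map (algebraMap ℝ ℂ) with hq
  have hqz : q.eval z ≠ 0 := hp.eval_map_ne_zero hz
  have h1 : q.eval z = t * q.derivative.eval z := by
    rw [hq, derivative_map, eval_map_algebraMap, eval_map_algebraMap]
    simpa [sub_eq_zero] using h0
  have ht : (t : ℂ) ≠ 0 := by
    intro ht
    rw [ht, zero_mul] at h1
    exact hqz h1
  have hd : q.derivative.eval z ≠ 0 := by
    intro hd
    rw [hd, mul_zero] at h1
    exact hqz h1
  have hW : q.derivative.eval z / q.eval z = ((t⁻¹ : ℝ) : ℂ) := by
    rw [h1]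
    push_cast
    field_simp
  have hle := norm_derivative_div_eval_add_le le_rfl (fun z hz => hp.eval_map_ne_zero hz) hz
  rw [← hq, hW] at hle
  -- The boundary of the disk is tangent to the real axis at the origin.
  have hc : (q.natDegree : ℂ) * (Complex.I / (2 * z.im)) =
      ((q.natDegree / (2 * z.im) : ℝ) : ℂ) * Complex.I := by
    push_cast
    ring
  have hc' : (q.natDegree : ℝ) * ‖Complex.I / (2 * z.im : ℂ)‖ =
      ‖((q.natDegree / (2 * z.im) : ℝ) : ℂ) * Complex.I‖ := by
    rw [← hc, norm_mul, Complex.norm_natCast]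
  rw [hc', hc, ← sq_le_sq₀ (norm_nonneg _) (norm_nonneg _), Complex.sq_norm, Complex.sq_norm,
    Complex.normSq_add_mul_I, ← zero_add (_ * Complex.I), ← Complex.ofReal_zero,
    Complex.normSq_add_mul_I] at hle
  have : 0 < (t⁻¹) ^ 2 := by
    have : t ≠ 0 := by exact_mod_cast ht
    positivity
  linarith

/-! ### Monic polynomials as constant-coefficient differential operators -/

lemma degree_sum_C_mul_X_pow_sub_lt (d : ℕ) (b : Fin d → ℝ) :
    (∑ i : Fin d, C (b i) * X ^ (d - ((i : ℕ) + 1))).degree < (d : WithBot ℕ) := by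
  refine (degree_sum_le _ _).trans_lt ((Finset.sup_lt_iff (WithBot.bot_lt_coe d)).2 fun i _ => ?_)
  refine (degree_C_mul_X_pow_le _ _).trans_lt ?_
  have := i.2
  exact Nat.cast_lt.2 (by omega)

lemma monic_monicPoly (d : ℕ) (b : Fin d → ℝ) : (monicPoly d b).Monic :=
  monic_X_pow_add (degree_sum_C_mul_X_pow_sub_lt d b)

lemma natDegree_monicPoly (d : ℕ) (b : Fin d → ℝ) : (monicPoly d b).natDegree = d :=
  by
  rw [monicPoly, natDegree_add_eq_left_of_degree_lt, natDegree_X_pow]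
  rw [degree_X_pow]
  exact degree_sum_C_mul_X_pow_sub_lt d b

lemma coeff_monicPoly (d : ℕ) (b : Fin d → ℝ) (i : Fin d) :
    (monicPoly d b).coeff (d - ((i : ℕ) + 1)) = b i := by
  have hi := i.2
  rw [monicPoly, coeff_add, coeff_X_pow, if_neg (by omega), zero_add, finsetSum_coeff,
    Finset.sum_eq_single i]
  · simp
  · intro j _ hj
    have hj' := j.2
    have : (j : ℕ) ≠ i := fun h => hj (Fin.ext h)
    rw [coeff_C_mul_X_pow, if_neg (by omega)]
  · simp

lemma nuijPoly_eq_aeval (d : ℕ) (a : Fin d → ℝ) (p : ℝ[X]) (s : ℝ) :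
    nuijPoly d a p s =
      aeval (s • (derivative : Module.End ℝ ℝ[X])) (reflect d (monicPoly d a)) p := by
  have h : reflect d (monicPoly d a) = 1 + ∑ i : Fin d, C (a i) * X ^ ((i : ℕ) + 1) := by
    have hsum : ∀ t : Finset (Fin d),
        reflect d (∑ i ∈ t, C (a i) * X ^ (d - ((i : ℕ) + 1))) =
          ∑ i ∈ t, C (a i) * X ^ ((i : ℕ) + 1) := by
      intro t
      induction t using Finset.induction_on with
      | empty => simp
      | insert i t hi ih =>
        have := i.2
        rw [Finset.sum_insert hi, Finset.sum_insert hi, reflect_add, ih, reflect_C_mul_X_pow,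
          revAt_le (by omega), Nat.sub_sub_self (by omega)]
    rw [monicPoly, reflect_add, hsum, reflect_monomial, revAt_le le_rfl, Nat.sub_self, pow_zero]
  rw [h, nuijPoly]
  simp only [map_add, map_one, map_sum, map_mul, map_pow, aeval_C, aeval_X, LinearMap.add_apply,
    Module.End.one_apply, LinearMap.sum_apply, Module.End.mul_apply, _root_.smul_pow,
    LinearMap.smul_apply, Module.algebraMap_end_apply, Module.End.pow_apply, smul_eq_C_mul,
    mul_assoc]

/-- The operator obtained from `∏ (X - r_i)` by reversing the coefficients and substituting `s D`
for the variable is `∏ (1 - r_i s D)`. -/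
lemma Hyperbolic.aeval_reflect_prod {p : ℝ[X]} (hp : Hyperbolic p) (s : ℝ) (m : Multiset ℝ) :
    Hyperbolic (aeval (s • (derivative : Module.End ℝ ℝ[X]))
      (reflect m.card (m.map fun r => X - C r).prod) p) := by
  induction m using Multiset.induction_on with
  | empty => simpa using hp
  | cons r m ih =>
    have hr : reflect 1 (X - C r) = 1 - C r * X := by
      rw [reflect_sub, reflect_one_X, reflect_C, pow_one]
    rw [Multiset.map_cons, Multiset.prod_cons, Multiset.card_cons, add_comm,
      reflect_mul _ _ (natDegree_X_sub_C_le r) (natDegree_multiset_prod_X_sub_C_eq_card m).le, hr,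
      map_mul, Module.End.mul_apply]
    convert ih.sub_C_mul_derivative (r * s) using 1
    simp [smul_eq_C_mul, mul_assoc, mul_left_comm]

lemma hyperbolicSet_subset_nuijSet (d : ℕ) : hyperbolicSet d ⊆ nuijSet d := by
  intro a ha p _ hp s
  have hsplit : (monicPoly d a).Splits := Hyperbolic.splits ha
  have hprod := hsplit.eq_prod_roots_of_monic (monic_monicPoly d a)
  have hcard := hsplit.natDegree_eq_card_roots
  rw [natDegree_monicPoly] at hcard
  have h := hp.aeval_reflect_prod s (monicPoly d a).roots
  rwa [← hprod, ← hcard, ← nuijPoly_eq_aeval] at h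

/-! ### Nuij sequences and the scaling map -/

lemma nuijPoly_X_pow (d : ℕ) (a : Fin d → ℝ) :
    nuijPoly d a (X ^ d) 1 = monicPoly d (scaleMap d a) := by
  rw [nuijPoly, monicPoly]
  congr 1
  refine Finset.sum_congr rfl fun i _ => ?_
  have hi : (i : ℕ) + 1 ≤ d := i.2
  rw [iterate_derivative_X_pow_eq_C_mul, ← mul_assoc, ← C_mul]
  congr 2
  have : ((d - ((i : ℕ) + 1)).factorial : ℝ) ≠ 0 := by positivity
  have h := Nat.factorial_mul_descFactorial hi
  rw [scaleMap, LinearMap.coe_mk, AddHom.coe_mk, ← h]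
  push_cast
  field_simp
  simp

lemma iterate_derivative_comp_C_sub_X (P : ℂ[X]) (w : ℂ) (k : ℕ) :
    derivative^[k] (P.comp (C w - X)) = (-1) ^ k * (derivative^[k] P).comp (C w - X) := by
  induction k with
  | zero => simp
  | succ k ih =>
    rw [Function.iterate_succ_apply', ih, Function.iterate_succ_apply', pow_succ]
    have : ((-1 : ℂ[X]) ^ k) = C ((-1) ^ k) := by simp
    rw [this, derivative_C_mul, derivative_comp]
    simp

/-- The apolarity pairing of `p(w - z)` and the monic polynomial with coefficient vector `b_d a`
is, up to the factor `d!`, the value at `w` of `p + ∑ a_k p^{(k)}`. -/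
lemma eval_apolarForm_monicPoly (d : ℕ) (a : Fin d → ℝ) (p : ℝ[X]) (w : ℂ) :
    (apolarForm d ((p.map (algebraMap ℝ ℂ)).comp (C w - X))
      ((monicPoly d (scaleMap d a)).map (algebraMap ℝ ℂ))).eval 0 =
      d.factorial * aeval w (nuijPoly d a p 1) := by
  have hterm : ∀ k, ((-1 : ℂ[X]) ^ k *
      derivative^[k] ((p.map (algebraMap ℝ ℂ)).comp (C w - X)) *
        derivative^[d - k] ((monicPoly d (scaleMap d a)).map (algebraMap ℝ ℂ))).eval 0 =
      aeval w (derivative^[k] p) *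
        ((d - k).factorial * ((monicPoly d (scaleMap d a)).coeff (d - k) : ℝ)) := by
    intro k
    have hQ : (derivative^[d - k] ((monicPoly d (scaleMap d a)).map (algebraMap ℝ ℂ))).eval 0 =
        (d - k).factorial * ((monicPoly d (scaleMap d a)).coeff (d - k) : ℝ) := by
      rw [← coeff_zero_eq_eval_zero, coeff_iterate_derivative, zero_add, Nat.descFactorial_self,
        coeff_map, nsmul_eq_mul]
      rfl
    rw [iterate_derivative_comp_C_sub_X, ← mul_assoc, ← mul_pow, neg_one_mul, neg_neg, one_pow,
      one_mul, eval_mul, hQ, eval_comp, iterate_derivative_map, eval_map_algebraMap]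
    simp
  rw [apolarForm, eval_finsetSum, Finset.sum_congr rfl fun k _ => hterm k, Finset.sum_range_succ',
    nuijPoly, map_add, map_sum, mul_add, Finset.mul_sum, Finset.sum_range, add_comm]
  congr 1
  · have : (monicPoly d (scaleMap d a)).coeff d = 1 := by
      simpa [natDegree_monicPoly] using (monic_monicPoly d (scaleMap d a)).coeff_natDegree
    simp [this, mul_comm]
  · refine Finset.sum_congr rfl fun i _ => ?_
    rw [coeff_monicPoly]
    have : ((d - ((i : ℕ) + 1)).factorial : ℂ) ≠ 0 :=
      Nat.cast_ne_zero.2 (Nat.factorial_ne_zero _)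
    simp only [scaleMap, LinearMap.coe_mk, AddHom.coe_mk, map_mul, aeval_C]
    simp
    field_simp

/-- Rescaling the variable by `s` reduces a general parameter `s` to `s = 1`. -/
lemma hyperbolic_monicPoly_pow_mul {d : ℕ} {b : Fin d → ℝ} (hb : Hyperbolic (monicPoly d b))
    (s : ℝ) : Hyperbolic (monicPoly d fun i => b i * s ^ ((i : ℕ) + 1)) := by
  intro z hz
  rcases eq_or_ne s 0 with rfl | hs
  · have hz0 : z = 0 := by
      by_contra h
      simp [monicPoly, h] at hz
    simp [hz0]
  · have hs' : (s : ℂ) ≠ 0 := by exact_mod_cast hs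
    have h : aeval z (monicPoly d fun i => b i * s ^ ((i : ℕ) + 1)) =
        (s : ℂ) ^ d * aeval (z / s) (monicPoly d b) := by
      simp only [monicPoly, map_add, map_sum, map_mul, map_pow, aeval_X, aeval_C, mul_add,
        Finset.mul_sum]
      congr 1
      · rw [div_pow]
        field_simp
      · refine Finset.sum_congr rfl fun i _ => ?_
        have hi : (s : ℂ) ^ d = s ^ ((i : ℕ) + 1) * s ^ (d - ((i : ℕ) + 1)) := by
          rw [← pow_add, Nat.add_sub_cancel' (show (i : ℕ) + 1 ≤ d from i.2)]
        rw [hi, div_pow]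
        simp
        field_simp
    rw [h] at hz
    have h0 := hb _ ((mul_eq_zero.1 hz).resolve_left (pow_ne_zero _ hs'))
    rw [Complex.div_ofReal_im] at h0
    exact (div_eq_zero_iff.1 h0).resolve_right hs

lemma hyperbolic_nuijPoly_one {d : ℕ} {a : Fin d → ℝ}
    (ha : Hyperbolic (monicPoly d (scaleMap d a))) {p : ℝ[X]} (hdeg : p.degree = d)
    (hp : Hyperbolic p) : Hyperbolic (nuijPoly d a p 1) := by
  refine hyperbolic_iff.2 fun w hw h0 => ?_
  set f := (p.map (algebraMap ℝ ℂ)).comp (C w - X) with hf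
  have hsplit := IsAlgClosed.splits f
  have hlin : (C w - X : ℂ[X]).natDegree = 1 := by
    rw [← neg_sub, natDegree_neg, natDegree_X_sub_C]
  have hfdeg : f.natDegree = d := by
    rw [hf, natDegree_comp, hlin, mul_one, natDegree_map, natDegree_eq_of_degree_eq_some hdeg]
  have hcard : f.roots.card = d := hsplit.natDegree_eq_card_roots ▸ hfdeg
  have hp0 : p ≠ 0 := by
    rintro rfl
    simp at hdeg
  have hf0 : f ≠ 0 := by
    intro h
    rw [hf, comp_eq_zero_iff] at h
    rcases h with h | ⟨-, h⟩
    · exact hp0 ((Polynomial.map_eq_zero _).1 h)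
    · rw [h, natDegree_C] at hlin
      exact zero_ne_one hlin
  have hroots : ∀ β ∈ f.roots, 0 < β.im := by
    intro β hβ
    have h := isRoot_of_mem_roots hβ
    rw [IsRoot.def, hf, eval_comp, eval_map_algebraMap] at h
    have := hp _ h
    simp only [eval_sub, eval_C, eval_X, Complex.sub_im] at this
    linarith
  have h := eval_apolarForm_ne_zero f.roots hroots (leadingCoeff_ne_zero.2 hf0)
    (q := (monicPoly d (scaleMap d a)).map (algebraMap ℝ ℂ))
    (by rw [hcard, natDegree_map, natDegree_monicPoly])
    (fun z hz => ha.eval_map_ne_zero hz) 0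
  rw [← hsplit.eq_prod_roots, hcard, hf, eval_apolarForm_monicPoly, h0, mul_zero] at h
  exact h rfl

lemma nuijSet_eq_preimage (d : ℕ) : nuijSet d = scaleMap d ⁻¹' hyperbolicSet d := by
  ext a
  constructor
  · intro ha
    have hX : Hyperbolic (X ^ d : ℝ[X]) := by
      intro z hz
      rw [map_pow, aeval_X] at hz
      simp [eq_zero_of_pow_eq_zero hz]
    have h := ha (X ^ d) (degree_X_pow d) hX 1
    rwa [nuijPoly_X_pow] at h
  · intro ha p hdeg hp s
    have hscale : Hyperbolic (monicPoly d (scaleMap d fun i => a i * s ^ ((i : ℕ) + 1))) := by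
      convert hyperbolic_monicPoly_pow_mul ha s using 2
      funext i
      simp [scaleMap, mul_assoc]
    simpa [nuijPoly] using hyperbolic_nuijPoly_one hscale hdeg hp

end Nuij

theorem mainTheorem4 (d : ℕ) :
    Nuij.hyperbolicSet d ⊆ Nuij.nuijSet d ∧
      Nuij.nuijSet d = Nuij.scaleMap d ⁻¹' Nuij.hyperbolicSet d :=
  ⟨Nuij.hyperbolicSet_subset_nuijSet d, Nuij.nuijSet_eq_preimage d⟩
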